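/- **Theorem.** There is an absolute constant $K>0$ such that the following holds for every $k\ge 0$, every set $V$, every function $f:\{0,1\}^{2^k}\to V$ and every ordering of its $2^k$ variables. Let $B$ be the BDD and let $C$ be the level-$k$ CFLOBDD for $f$, both with this variable ordering. Then the number $|G(C)|$ of groupings of $C$ satisfies $$|G(C)|\;\le\; K\,|B|\log |B| ,$$ that is, $|G(C)|=\mathcal O(|B|\log|B|)$, whether the size $|B|$ is the number of nodes of $B$ (terminal nodes included) or the number of its edges. Here a *BDD* is a quasi-reduced multi-terminal ordered binary decision diagram: a finite rooted directed acyclic graph that reads the variables one by one in the given order without skipping any, whose nodes are all reachable from the root, in which two different non-terminal nodes of equal depth never have the same pair (false-successor, true-successor), and in which different terminal nodes carry different values in $V$. The interpretation of an assignment is the value of the terminal node it leads to. A *mock-CFLOBDD* at level $k$ consists of finitely many groupings at levels $0,\dots,k$: one at level $k$ (the head), and every other grouping is called by some grouping one level up. A grouping has an entry vertex and an ordered list of exit vertices. At level $0$ it is a *don't-care grouping* (one exit, to which both branches lead) or a *fork grouping* (two exits, the branch for $0$ leading to the first and the branch for $1$ to the second). A grouping $g$ at level $l\ge 1$ also has an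 ordered list of middle vertices, an A-call from its entry vertex to a level-$(l-1)$ grouping with return edges from each exit of the callee to a middle vertex of $g$, and, for each middle vertex, a B-call to a level-$(l-1)$ grouping with return edges from each exit of the callee to an exit of $g$. Each exit of the head carries a value in $V$. An assignment is interpreted along a matched path: through a level-$l$ grouping, $l\ge1$, the first $2^{l-1}$ of its $2^l$ variables are read in the A-callee, the path returns along the matching A-return edge to a middle vertex $m$, the other $2^{l-1}$ variables are read in the B-callee of $m$, and the path returns along the matching B-return edge; a level-$0$ grouping reads one variable. The value at the exit of the head that is reached is the result. The *return tuple* of a call lists the targets of its return edges, in the order of the exits of the callee. Two groupings are *equal* if they head isomorphic hierarchical structures (same numbers of vertices, equal callees, same return tuples; the same kind at level $0$). A *CFLOBDD* is a mock-CFLOBDD such that 1. the return tuple of every A-call is $[1,2,\dots,r]$, where $r$ is both the number of exits of the callee and the number of middle vertices of the caller; 2. (a) the return tuple of every B-call has no repetitions; (b) if $n$ is the largest index that occurs in the return tuples of the B-calls of the earlier middle vertices of the same grouping ($n=0$ if there are none), then the subsequence of its entries greater than $n$ is $[n+1,\dots,n+m]$ for some $m\ge0$; and every exit of a grouping at level $\ge1$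 is the target of some B-return edge; 3. no two different groupings are equal; 4. two different B-calls of the same grouping that lead to equal groupings have different return tuples; 5. different exits of the head carry different values. -/

import Mathlib

/-!
Let `f` be the function represented by both diagrams.  A grouping of `C` is determined by its level
and by the partition of the assignments to its variables according to the exit that they reach.
Indeed, the structural invariants say that the exits are numbered in the order in which they are
first reached when the assignments are listed lexicographically, so the partition determines even
the number of the exit that an assignment reaches, and by induction on the level all callees and
return tuples can be read off from these numbers.

A grouping at level `l` is entered after some prefix of the input has been read.  That prefix leads
to a node `u` of `B`, and two blocks of `2 ^ l` Booleans reach the same exit of the grouping if and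
only if they lead from `u` to the same node of `B`, because in both diagrams this happens exactly
when the two continuations of the prefix have the same residual function.  Hence a grouping is
determined by its level and such a node `u`, which gives `|G(C)| ≤ (k + 1) M` where `M` is the
number of non-terminal nodes of `B`.  Every ply of `B` is inhabited, so `2 ^ k ≤ M`, and `k + 1` is
at most of order `log |B|`.
-/

universe u

/-- A quasi-reduced multi-terminal ordered binary decision diagram that reads `n` Boolean
variables (`BDD` for short): a finite rooted acyclic graph, stored ply by ply.  Plies are never
skipped, so the depth of a node (its distance from the root) is the number of variables read. -/
structure BDD (V : Type u) (n : ℕ) where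
  /-- the nodes at depth `d` -/
  Node : ℕ → Type
  finite_nodes : Finite (Σ d, Node d)
  no_node_below : ∀ d, n < d → IsEmpty (Node d)
  root : Node 0
  /-- the `false`-successor and the `true`-successor of a non-terminal node -/
  succ : ∀ {d : ℕ}, d < n → Node d → Bool → Node (d + 1)
  /-- the value of a terminal node -/
  value : Node n → V
  /-- the root is the only node at depth `0` -/
  root_unique : ∀ u : Node 0, u = root
  /-- every other node has a predecessor, so every node is reachable from the root -/
  reachable : ∀ {d : ℕ} (hd : d < n) (v : Node (d + 1)), ∃ (u : Node d) (b : Bool), succ hd u b = v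
  /-- maximal sharing: no two non-terminal nodes have the same pair of successors -/
  node_shared : ∀ {d : ℕ} (hd : d < n) (u v : Node d), (∀ b, succ hd u b = succ hd v b) → u = v
  /-- maximal sharing: no two terminal nodes have the same value -/
  value_shared : Function.Injective value

namespace BDD

variable {V : Type u} {n : ℕ}

/-- The node reached from the root after the first `d` variables have been interpreted; `a i` is
the Boolean that is read in step `i`. -/
def nodeAfter (B : BDD V n) (a : Fin n → Bool) : (d : ℕ) → d ≤ n → B.Node d
  | 0, _ => B.root
  | d + 1, h => B.succ h (B.nodeAfter a d (Nat.le_of_succ_le h)) (a ⟨d, h⟩)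

/-- The interpretation of an assignment, given as the sequence of Booleans in reading order. -/
def eval (B : BDD V n) (a : Fin n → Bool) : V :=
  B.value (B.nodeAfter a n le_rfl)

/-- `B` represents `f` with the variable ordering `ord`: the variable read in step `i` is
the variable number `ord i` of `f`. -/
def Represents (B : BDD V n) (ord : Equiv.Perm (Fin n)) (f : (Fin n → Bool) → V) : Prop :=
  ∀ x : Fin n → Bool, B.eval (fun i => x (ord i)) = f x

/-- The number of nodes (terminal and non-terminal). -/
noncomputable def numNodes (B : BDD V n) : ℕ :=
  Nat.card (Σ d, B.Node d)

/-- The number of edges: an edge is given by its source, a non-terminal node, and its label. -/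
noncomputable def numEdges (B : BDD V n) : ℕ :=
  Nat.card ({u : Σ d, B.Node d // u.1 < n} × Bool)

end BDD

/-- A mock-CFLOBDD at level `k`.  The exit vertices of a grouping `g` are `Fin (numExits g)`, its
middle vertices (if its level is at least `1`) are `Fin (numMids g)`, in their fixed order; the
entry vertex of `g` is not named separately. -/
structure MockCFLOBDD (V : Type u) (k : ℕ) where
  /-- the groupings at level `l` -/
  Grouping : ℕ → Type
  finite_groupings : Finite (Σ l, Grouping l)
  no_grouping_above : ∀ l, k < l → IsEmpty (Grouping l)
  /-- the one grouping at level `k` -/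
  head : Grouping k
  head_unique : ∀ g : Grouping k, g = head
  numExits : ∀ {l : ℕ}, Grouping l → ℕ
  numMids : ∀ {l : ℕ}, Grouping (l + 1) → ℕ
  /-- the left (`false`) and the right (`true`) branch of a level-`0` grouping -/
  branch : ∀ g : Grouping 0, Bool → Fin (numExits g)
  /-- a level-`0` grouping is a don't-care grouping or a fork grouping -/
  dontCare_or_fork : ∀ g : Grouping 0, numExits g = 1 ∨
    (numExits g = 2 ∧ (branch g false : ℕ) = 0 ∧ (branch g true : ℕ) = 1)
  /-- the target of the A-call edge -/
  aCall : ∀ {l : ℕ}, Grouping (l + 1) → Grouping l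
  /-- the A-return edges -/
  aRet : ∀ {l : ℕ} (g : Grouping (l + 1)), Fin (numExits (aCall g)) → Fin (numMids g)
  /-- the target of the B-call edge that leaves a middle vertex -/
  bCall : ∀ {l : ℕ} (g : Grouping (l + 1)), Fin (numMids g) → Grouping l
  /-- the B-return edges that match the B-call edge of a middle vertex -/
  bRet : ∀ {l : ℕ} (g : Grouping (l + 1)) (m : Fin (numMids g)),
    Fin (numExits (bCall g m)) → Fin (numExits g)
  /-- every grouping below level `k` is called; hence every grouping is connected to the head -/
  called : ∀ {l : ℕ}, l < k → ∀ g : Grouping l,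
    ∃ h : Grouping (l + 1), aCall h = g ∨ ∃ m, bCall h m = g
  /-- the value edges -/
  value : Fin (numExits head) → V

namespace MockCFLOBDD

variable {V : Type u} {k : ℕ}

/-- Every grouping has at least one exit vertex. -/
theorem numExits_pos (C : MockCFLOBDD V k) : ∀ {l : ℕ} (g : C.Grouping l), 0 < C.numExits g
  | 0, g => (Nat.zero_le _).trans_lt (C.branch g false).isLt
  | _ + 1, g =>
    let m := C.aRet g ⟨0, C.numExits_pos (C.aCall g)⟩
    (Nat.zero_le _).trans_lt (C.bRet g m ⟨0, C.numExits_pos (C.bCall g m)⟩).isLt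

/-- The exit vertex at which the matched path for `a` through the proto-CFLOBDD headed by `g`
ends.  At level `0` the next variable selects the branch.  At level `l + 1` the path follows the
A-call edge, reads the first half of `a` in the A-callee, returns along the matching A-return edge
to a middle vertex `m`, follows the B-call edge of `m`, reads the second half of `a` in that
B-callee, and returns along the matching B-return edge. -/
def run (C : MockCFLOBDD V k) :
    {l : ℕ} → (g : C.Grouping l) → (Fin (2 ^ l) → Bool) → Fin (C.numExits g)
  | 0, g, a => C.branch g (a ⟨0, by norm_num⟩)
  | l + 1, g, a =>
    let m := C.aRet g (C.run (C.aCall g) fun i => a ⟨i, by have := i.isLt; rw [pow_succ]; omega⟩)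
    C.bRet g m (C.run (C.bCall g m) fun i => a ⟨2 ^ l + i, by have := i.isLt; rw [pow_succ]; omega⟩)

/-- The interpretation of an assignment, given as the sequence of Booleans in reading order. -/
def eval (C : MockCFLOBDD V k) (a : Fin (2 ^ k) → Bool) : V :=
  C.value (C.run C.head a)

/-- `C` represents `f` with the variable ordering `ord`: the variable read in step `i` is
the variable number `ord i` of `f`. -/
def Represents (C : MockCFLOBDD V k) (ord : Equiv.Perm (Fin (2 ^ k)))
    (f : (Fin (2 ^ k) → Bool) → V) : Prop :=
  ∀ x : Fin (2 ^ k) → Bool, C.eval (fun i => x (ord i)) = f x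

/-- The number of groupings. -/
noncomputable def numGroupings (C : MockCFLOBDD V k) : ℕ :=
  Nat.card (Σ l, C.Grouping l)

/-- The return tuple of the A-call edge (indices start at `1`). -/
def aTuple (C : MockCFLOBDD V k) {l : ℕ} (g : C.Grouping (l + 1)) : List ℕ :=
  List.ofFn fun e => (C.aRet g e : ℕ) + 1

/-- The return tuple of the B-call edge of the middle vertex `m` (indices start at `1`). -/
def bTuple (C : MockCFLOBDD V k) {l : ℕ} (g : C.Grouping (l + 1)) (m : Fin (C.numMids g)) :
    List ℕ :=
  List.ofFn fun e => (C.bRet g m e : ℕ) + 1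

/-- The largest index (starting at `1`) of an exit vertex of `g` that occurs in the return tuples
of the B-connections of the middle vertices before `m`; it is `0` if there is none. -/
def lastExitBefore (C : MockCFLOBDD V k) {l : ℕ} (g : C.Grouping (l + 1))
    (m : Fin (C.numMids g)) : ℕ :=
  (Finset.univ.filter fun i : Fin (C.numMids g) => i < m).sup fun i =>
    Finset.univ.sup fun e => (C.bRet g i e : ℕ) + 1

/-- Equality (up to isomorphism) of the proto-CFLOBDDs headed by two groupings, defined along
their hierarchical structure. -/
def SameProto (C : MockCFLOBDD V k) : {l : ℕ} → C.Grouping l → C.Grouping l → Prop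
  | 0, g, h => C.numExits g = C.numExits h ∧ ∀ b, (C.branch g b : ℕ) = C.branch h b
  | _ + 1, g, h =>
    C.numExits g = C.numExits h ∧ C.numMids g = C.numMids h ∧
    C.SameProto (C.aCall g) (C.aCall h) ∧ C.aTuple g = C.aTuple h ∧
    ∀ (i : Fin (C.numMids g)) (j : Fin (C.numMids h)), (i : ℕ) = j →
      C.SameProto (C.bCall g i) (C.bCall h j) ∧ C.bTuple g i = C.bTuple h j

end MockCFLOBDD

/-- A CFLOBDD at level `k`: a mock-CFLOBDD that satisfies the structural invariants. -/
structure CFLOBDD (V : Type u) (k : ℕ) extends MockCFLOBDD V k where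
  /-- an A-call edge maps the exit vertices of its target identically onto the middle vertices -/
  a_identity : ∀ {l : ℕ} (g : Grouping (l + 1)),
    numMids g = numExits (aCall g) ∧
      toMockCFLOBDD.aTuple g = List.range' 1 (numExits (aCall g))
  /-- there are no repetitions in the return tuple of a B-call edge -/
  b_injective : ∀ {l : ℕ} (g : Grouping (l + 1)) (m : Fin (numMids g)),
    Function.Injective (bRet g m)
  /-- the return tuple of a B-call edge compactly extends the earlier ones: the sub-sequence of
  its entries greater than `n` is `[n + 1, n + 2, …]`, where `n` is the largest earlier entry -/
  b_compact : ∀ {l : ℕ} (g : Grouping (l + 1)) (m : Fin (numMids g)),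
    let n := toMockCFLOBDD.lastExitBefore g m
    let R := (toMockCFLOBDD.bTuple g m).filter fun i => n < i
    R = List.range' (n + 1) R.length
  /-- the exit vertices are those defined by the return tuples of the B-connections -/
  exits_defined : ∀ {l : ℕ} (g : Grouping (l + 1)) (e : Fin (numExits g)),
    ∃ (m : Fin (numMids g)) (e' : Fin (numExits (bCall g m))), bRet g m e' = e
  /-- there are no two separate instances of equal proto-CFLOBDDs -/
  no_duplicates : ∀ {l : ℕ} (g h : Grouping l), toMockCFLOBDD.SameProto g h → g = h
  /-- two B-call edges of a grouping that lead to equal proto-CFLOBDDs have different return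
  tuples -/
  b_distinct : ∀ {l : ℕ} (g : Grouping (l + 1)) (i j : Fin (numMids g)), i ≠ j →
    toMockCFLOBDD.SameProto (bCall g i) (bCall g j) →
      toMockCFLOBDD.bTuple g i ≠ toMockCFLOBDD.bTuple g j
  /-- the value tuple maps the exit vertices of the head to distinct values -/
  value_injective : Function.Injective value

open Function

section Kernels

variable {α β γ δ ε : Type*}

theorem ker_comp_of_injective {f : β → γ} (hf : Injective f) (φ : α → β) :
    Setoid.ker (f ∘ φ) = Setoid.ker φ :=
  Setoid.ext fun _ _ => hf.eq_iff

theorem ker_curry_eq_of_ker_eq {φ : γ → δ} {ψ : γ → ε} (h : Setoid.ker φ = Setoid.ker ψ)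
    (op : α → β → γ) :
    (Setoid.ker fun a b => φ (op a b)) = Setoid.ker fun a b => ψ (op a b) :=
  Setoid.ext fun a a' => by
    simp only [Setoid.ker_def, funext_iff]
    exact forall_congr' fun b => Setoid.ext_iff.1 h _ _

/-- Restricted growth: before `φ` takes a value, it has taken every smaller value.  Equivalently,
`φ` numbers its level sets in the order of their first elements. -/
def IsRestrictedGrowth [LT α] (φ : α → ℕ) : Prop :=
  ∀ a, ∀ x < φ a, ∃ a' < a, φ a' = x

theorem IsRestrictedGrowth.eq_of_ker_eq [LT α] [WellFoundedLT α] {φ ψ : α → ℕ}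
    (hφ : IsRestrictedGrowth φ) (hψ : IsRestrictedGrowth ψ) (h : Setoid.ker φ = Setoid.ker ψ) :
    φ = ψ := by
  ext a
  induction a using WellFoundedLT.induction with
  | ind a ih =>
    rcases lt_trichotomy (φ a) (ψ a) with hlt | heq | hgt
    · obtain ⟨a', ha', hψa'⟩ := hψ a _ hlt
      have hker : ψ a' = ψ a := (Setoid.ext_iff.1 h a' a).1 ((ih a' ha').trans hψa')
      omega
    · exact heq
    · obtain ⟨a', ha', hφa'⟩ := hφ a _ hgt
      have hker : φ a' = φ a := (Setoid.ext_iff.1 h a' a).2 ((ih a' ha').symm.trans hφa')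
      omega

end Kernels

section Lex

variable {α : Type*} [LT α] {m n : ℕ}

theorem toLex_append_lt_of_lt_left {a a' : Fin m → α} (h : toLex a < toLex a')
    (b b' : Fin n → α) : toLex (Fin.append a b) < toLex (Fin.append a' b') := by
  obtain ⟨i, heq, hlt⟩ := h
  refine ⟨i.castAdd n, fun j hj => ?_, ?_⟩
  · obtain ⟨j, rfl⟩ : ∃ j' : Fin m, j'.castAdd n = j :=
      ⟨j.castLT ((Fin.lt_def.1 hj).trans i.isLt), rfl⟩
    simpa only [Pi.toLex_apply, Fin.append_left] using heq j hj
  · simpa only [Pi.toLex_apply, Fin.append_left] using hlt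

theorem toLex_append_lt_of_lt_right (a : Fin m → α) {b b' : Fin n → α}
    (h : toLex b < toLex b') : toLex (Fin.append a b) < toLex (Fin.append a b') := by
  obtain ⟨i, heq, hlt⟩ := h
  refine ⟨i.natAdd m, fun j hj => ?_, ?_⟩
  · induction j using Fin.addCases with
    | left j => simp only [Pi.toLex_apply, Fin.append_left]
    | right j =>
      simpa only [Pi.toLex_apply, Fin.append_right] using heq j ((Fin.natAdd_lt_natAdd_iff m).1 hj)
  · simpa only [Pi.toLex_apply, Fin.append_right] using hlt

theorem toLex_comp_cast_lt_iff (h : m = n) {a a' : Fin n → α} :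
    toLex (a ∘ Fin.cast h) < toLex (a' ∘ Fin.cast h) ↔ toLex a < toLex a' := by
  subst h
  rfl

end Lex

/-- An assignment to the `2 ^ l` variables that are read by a grouping at level `l`. -/
abbrev Assignment (l : ℕ) := Fin (2 ^ l) → Bool

namespace Assignment

variable {l : ℕ}

theorem two_pow_succ_eq_add (l : ℕ) : 2 ^ (l + 1) = 2 ^ l + 2 ^ l := by
  rw [pow_succ, mul_two]

/-- The assignment that consists of `a` followed by `b`: the A-callee of a grouping at level `l + 1`
reads `a` and the B-callee reads `b`. -/
def append (a b : Assignment l) : Assignment (l + 1) :=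
  Fin.append a b ∘ Fin.cast (two_pow_succ_eq_add l)

theorem append_left (a b : Assignment l) (i : Fin (2 ^ l)) (h : (i : ℕ) < 2 ^ (l + 1)) :
    a.append b ⟨i, h⟩ = a i :=
  Fin.append_left a b i

theorem append_right (a b : Assignment l) (i : Fin (2 ^ l)) (h : 2 ^ l + (i : ℕ) < 2 ^ (l + 1)) :
    a.append b ⟨2 ^ l + i, h⟩ = b i :=
  Fin.append_right a b i

theorem exists_append_eq (c : Assignment (l + 1)) : ∃ a b : Assignment l, a.append b = c := by
  let c' := c ∘ Fin.cast (two_pow_succ_eq_add l).symm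
  refine ⟨fun i => c' (i.castAdd _), fun i => c' (i.natAdd _), ?_⟩
  rw [append, Fin.append_castAdd_natAdd]
  rfl

theorem toLex_append_lt_of_lt_left {a a' : Assignment l} (h : toLex a < toLex a')
    (b b' : Assignment l) : toLex (a.append b) < toLex (a'.append b') :=
  (toLex_comp_cast_lt_iff _).2 (_root_.toLex_append_lt_of_lt_left h b b')

theorem toLex_append_lt_of_lt_right (a : Assignment l) {b b' : Assignment l}
    (h : toLex b < toLex b') : toLex (a.append b) < toLex (a.append b') :=
  (toLex_comp_cast_lt_iff _).2 (_root_.toLex_append_lt_of_lt_right a h)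

end Assignment

namespace BDD

variable {V : Type u} {n : ℕ}

/-- The nodes of all depths, i.e. the nodes of the underlying graph; bundling the depth avoids
casts between plies. -/
abbrev Vertex (B : BDD V n) := Σ d, B.Node d

/-- The non-terminal nodes, which are those of depth less than `n`. -/
abbrev Nonterminal (B : BDD V n) := {u : B.Vertex // u.1 < n}

/-- The successor of a node along the edge labelled `b`; terminal nodes are their own successors, to
make the function total. -/
def step (B : BDD V n) (u : B.Vertex) (b : Bool) : B.Vertex :=
  if h : u.1 < n then ⟨u.1 + 1, B.succ h u.2 b⟩ else u

/-- The node that is reached from `u` by reading the Booleans `a 0, …, a (m - 1)`. -/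
def walk (B : BDD V n) {m : ℕ} (u : B.Vertex) (a : Fin m → Bool) : B.Vertex :=
  Fin.foldl m (fun v i => B.step v (a i)) u

theorem step_of_lt (B : BDD V n) {u : B.Vertex} (h : u.1 < n) (b : Bool) :
    B.step u b = ⟨u.1 + 1, B.succ h u.2 b⟩ :=
  dif_pos h

theorem walk_cons (B : BDD V n) {m : ℕ} (u : B.Vertex) (b : Bool) (a : Fin m → Bool) :
    B.walk u (Fin.cons b a : Fin (m + 1) → Bool) = B.walk (B.step u b) a :=
  Fin.foldl_succ _ _

theorem walk_succ_last (B : BDD V n) {m : ℕ} (u : B.Vertex) (a : Fin (m + 1) → Bool) :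
    B.walk u a = B.step (B.walk u fun i => a i.castSucc) (a (Fin.last m)) :=
  Fin.foldl_succ_last _ _

theorem walk_append (B : BDD V n) {m m' : ℕ} (u : B.Vertex) (a : Fin m → Bool)
    (b : Fin m' → Bool) : B.walk u (Fin.append a b) = B.walk (B.walk u a) b := by
  simp only [walk, Fin.foldl_add, Fin.append_left', Fin.append_right]

theorem walk_assignment_append (B : BDD V n) {l : ℕ} (u : B.Vertex) (a b : Assignment l) :
    B.walk u (a.append b) = B.walk (B.walk u a) b := by
  have walk_comp_cast : ∀ {m m' : ℕ} (h : m = m') (c : Fin m' → Bool),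
      B.walk u (c ∘ Fin.cast h) = B.walk u c := by
    rintro m _ rfl c
    rfl
  rw [Assignment.append, walk_comp_cast, walk_append]

theorem fst_walk (B : BDD V n) {m : ℕ} (u : B.Vertex) (a : Fin m → Bool) (h : u.1 + m ≤ n) :
    (B.walk u a).1 = u.1 + m := by
  induction m with
  | zero => rfl
  | succ m ih =>
    have hprefix := ih (fun i => a i.castSucc) (by omega)
    rw [walk_succ_last, B.step_of_lt (by omega)]
    exact congrArg (· + 1) hprefix

theorem walk_root_eq_nodeAfter (B : BDD V n) (a : Fin n → Bool) :
    ∀ (d : ℕ) (h : d ≤ n),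
      B.walk ⟨0, B.root⟩ (fun i : Fin d => a (i.castLE h)) = ⟨d, B.nodeAfter a d h⟩
  | 0, _ => rfl
  | d + 1, h => by
    have hprefix := B.walk_root_eq_nodeAfter a d (Nat.le_of_succ_le h)
    rw [walk_succ_last]
    exact (congrArg (B.step · _) hprefix).trans (B.step_of_lt (u := ⟨d, _⟩) h _)

theorem ker_walk_root (B : BDD V n) :
    Setoid.ker (fun a : Fin n → Bool => B.walk ⟨0, B.root⟩ a) = Setoid.ker B.eval :=
  Setoid.ext fun a a' => by
    have hwalk : ∀ c : Fin n → Bool, B.walk ⟨0, B.root⟩ c = ⟨n, B.nodeAfter c n le_rfl⟩ :=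
      fun c => B.walk_root_eq_nodeAfter c n le_rfl
    simp only [Setoid.ker_def, hwalk, eval, B.value_shared.eq_iff, Sigma.mk.injEq, heq_eq_eq,
      true_and]

theorem eq_of_forall_walk_eq (B : BDD V n) (m : ℕ) {u v : B.Vertex} (hdepth : u.1 = v.1)
    (hm : u.1 + m ≤ n) (h : ∀ a : Fin m → Bool, B.walk u a = B.walk v a) : u = v := by
  induction m generalizing u v with
  | zero => exact h Fin.elim0
  | succ m ih =>
    obtain ⟨d, u⟩ := u
    obtain ⟨_, v⟩ := v
    obtain rfl : d = _ := hdepth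
    have hd : d < n := by simp only at hm; omega
    have hstep : ∀ b, B.step ⟨d, u⟩ b = B.step ⟨d, v⟩ b := fun b => by
      refine ih ?_ ?_ fun a => ?_
      · rw [B.step_of_lt hd, B.step_of_lt hd]
      · rw [B.step_of_lt hd]
        simp only at hm ⊢
        omega
      · rw [← walk_cons, ← walk_cons]
        exact h _
    congr 1
    refine B.node_shared hd u v fun b => ?_
    have hsucc := hstep b
    rw [B.step_of_lt hd, B.step_of_lt hd] at hsucc
    exact eq_of_heq (Sigma.mk.inj hsucc).2

theorem ker_walk_eq_ker_walk_walk (B : BDD V n) {m m' : ℕ} (u : B.Vertex)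
    (h : u.1 + m + m' ≤ n) :
    Setoid.ker (fun a : Fin m → Bool => B.walk u a) =
      Setoid.ker fun (a : Fin m → Bool) (b : Fin m' → Bool) => B.walk (B.walk u a) b :=
  Setoid.ext fun a a' => by
    have hdepth : ∀ c : Fin m → Bool, (B.walk u c).1 = u.1 + m := fun c =>
      B.fst_walk u c (by omega)
    simp only [Setoid.ker_def, funext_iff]
    exact ⟨fun heq b => by rw [heq], B.eq_of_forall_walk_eq m' (by rw [hdepth, hdepth])
      (by rw [hdepth]; exact h)⟩

theorem nonempty_node (B : BDD V n) : ∀ d ≤ n, Nonempty (B.Node d)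
  | 0, _ => ⟨B.root⟩
  | d + 1, h =>
    let ⟨u⟩ := B.nonempty_node d (Nat.le_of_succ_le h)
    ⟨B.succ h u false⟩

theorem le_card_nonterminal (B : BDD V n) : n ≤ Nat.card B.Nonterminal := by
  have := B.finite_nodes
  let node : Fin n → B.Nonterminal := fun i =>
    ⟨⟨i, (B.nonempty_node i i.isLt.le).some⟩, i.isLt⟩
  have node_injective : Injective node := fun i j h =>
    Fin.ext (congrArg (fun u : B.Nonterminal => u.1.1) h)
  simpa only [Nat.card_fin] using Nat.card_le_card_of_injective node node_injective

theorem card_nonterminal_lt_numNodes (B : BDD V n) : Nat.card B.Nonterminal < B.numNodes := by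
  have := B.finite_nodes
  obtain ⟨t⟩ := B.nonempty_node n le_rfl
  exact Finite.card_subtype_lt (x := (⟨n, t⟩ : B.Vertex)) (lt_irrefl n)

theorem numEdges_eq_card_nonterminal_mul_two (B : BDD V n) :
    B.numEdges = Nat.card B.Nonterminal * 2 := by
  rw [numEdges, Nat.card_prod, Nat.card_eq_fintype_card (α := Bool), Fintype.card_bool]

end BDD

namespace MockCFLOBDD

variable {V : Type u} {k l : ℕ}

/-- The middle vertex of `g` that is reached by the matched path for `a` through the A-callee. -/
def midAfter (C : MockCFLOBDD V k) (g : C.Grouping (l + 1)) (a : Assignment l) :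
    Fin (C.numMids g) :=
  C.aRet g (C.run (C.aCall g) a)

theorem run_append (C : MockCFLOBDD V k) (g : C.Grouping (l + 1)) (a b : Assignment l) :
    C.run g (a.append b) =
      C.bRet g (C.midAfter g a) (C.run (C.bCall g (C.midAfter g a)) b) := by
  have hleft : (fun i : Fin (2 ^ l) => a.append b ⟨i, by have := i.isLt; omega⟩) = a :=
    funext fun i => Assignment.append_left a b i _
  have hright : (fun i : Fin (2 ^ l) => a.append b ⟨2 ^ l + i, by have := i.isLt; omega⟩) = b :=
    funext fun i => Assignment.append_right a b i _
  rw [run, hright, hleft]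
  rfl

theorem lt_lastExitBefore_iff (C : MockCFLOBDD V k) (g : C.Grouping (l + 1))
    (m : Fin (C.numMids g)) (x : ℕ) :
    x < C.lastExitBefore g m ↔ ∃ i < m, ∃ e, x ≤ C.bRet g i e := by
  simp only [lastExitBefore, Finset.lt_sup_iff, Finset.mem_filter_univ, Finset.mem_univ, true_and,
    Nat.lt_succ_iff]

theorem sameProto_refl (C : MockCFLOBDD V k) : ∀ {l : ℕ} (g : C.Grouping l), C.SameProto g g
  | 0, _ => ⟨rfl, fun _ => rfl⟩
  | _ + 1, g => by
    refine ⟨rfl, rfl, C.sameProto_refl _, rfl, fun i j hij => ?_⟩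
    obtain rfl := Fin.ext hij
    exact ⟨C.sameProto_refl _, rfl⟩

end MockCFLOBDD

namespace CFLOBDD

variable {V : Type u} {k l : ℕ} (C : CFLOBDD V k)

theorem aRet_val (g : C.Grouping (l + 1)) (e : Fin (C.numExits (C.aCall g))) :
    (C.aRet g e : ℕ) = e := by
  have h := List.getElem_of_eq (C.a_identity g).2 (i := (e : ℕ)) (by simp [MockCFLOBDD.aTuple])
  simp only [MockCFLOBDD.aTuple, List.getElem_ofFn, List.getElem_range', Fin.eta] at h
  omega

theorem midAfter_val (g : C.Grouping (l + 1)) (a : Assignment l) :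
    (C.midAfter g a : ℕ) = C.run (C.aCall g) a :=
  C.aRet_val g _

theorem aRet_injective (g : C.Grouping (l + 1)) : Injective (C.aRet g) := fun e e' h =>
  Fin.ext (by rw [← C.aRet_val g e, h, C.aRet_val])

theorem aRet_surjective (g : C.Grouping (l + 1)) : Surjective (C.aRet g) := fun m =>
  ⟨⟨m, (C.a_identity g).1 ▸ m.isLt⟩, Fin.ext (C.aRet_val g _)⟩

theorem branch_surjective (g : C.Grouping 0) : Surjective (C.branch g) := fun e => by
  have he := e.isLt
  rcases C.dontCare_or_fork g with h | ⟨h, h0, h1⟩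
  · have := (C.branch g false).isLt
    exact ⟨false, Fin.ext (by omega)⟩
  · obtain he0 | he1 : (e : ℕ) = 0 ∨ (e : ℕ) = 1 := by omega
    · exact ⟨false, Fin.ext (h0.trans he0.symm)⟩
    · exact ⟨true, Fin.ext (h1.trans he1.symm)⟩

theorem run_surjective : ∀ {l : ℕ} (g : C.Grouping l), Surjective (C.run g)
  | 0, g => fun e =>
    let ⟨b, hb⟩ := C.branch_surjective g e
    ⟨fun _ => b, hb⟩
  | _ + 1, g => fun e => by
    obtain ⟨m, e, rfl⟩ := C.exits_defined g e
    obtain ⟨c, rfl⟩ := C.aRet_surjective g m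
    obtain ⟨a, rfl⟩ := run_surjective _ c
    obtain ⟨b, rfl⟩ := run_surjective _ e
    exact ⟨Assignment.append a b, C.run_append g a b⟩

theorem midAfter_surjective (g : C.Grouping (l + 1)) : Surjective (C.midAfter g) :=
  (C.aRet_surjective g).comp (C.run_surjective _)

section ExitOrder

variable (g : C.Grouping (l + 1)) (m : Fin (C.numMids g))

theorem exists_bRet_eq_of_lastExitBefore_le {e : Fin (C.numExits (C.bCall g m))} {x : ℕ}
    (hx : C.lastExitBefore g m ≤ x) (hxe : x < C.bRet g m e) :
    ∃ f, (C.bRet g m f : ℕ) = x := by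
  have mem_newExits_iff : ∀ y, C.lastExitBefore g m ≤ y →
      (y + 1 ∈ (C.bTuple g m).filter (C.lastExitBefore g m < ·) ↔
        ∃ f, (C.bRet g m f : ℕ) = y) := fun y hy => by
    simp [MockCFLOBDD.bTuple, List.mem_ofFn, hy]
  have hmem := (mem_newExits_iff _ (hx.trans hxe.le)).2 ⟨e, rfl⟩
  refine (mem_newExits_iff x hx).1 ?_
  rw [C.b_compact g m, List.mem_range'_1] at hmem ⊢
  omega

theorem bRet_lt_bRet_of_lastExitBefore_le {e f : Fin (C.numExits (C.bCall g m))} (hef : e < f)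
    (he : C.lastExitBefore g m ≤ C.bRet g m e) (hf : C.lastExitBefore g m ≤ C.bRet g m f) :
    C.bRet g m e < C.bRet g m f := by
  have newExits_sorted :
      ((C.bTuple g m).filter (C.lastExitBefore g m < ·)).Pairwise (· < ·) := by
    rw [C.b_compact g m]
    exact List.pairwise_lt_range'
  rw [List.pairwise_filter, MockCFLOBDD.bTuple, List.pairwise_ofFn] at newExits_sorted
  have hlt := newExits_sorted hef (decide_eq_true (by omega)) (decide_eq_true (by omega))
  exact Fin.lt_def.2 (by omega)

theorem exists_bRet_eq_of_lt {e : Fin (C.numExits (C.bCall g m))} {x : ℕ}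
    (hx : x < C.bRet g m e) :
    (∃ i < m, ∃ f, (C.bRet g i f : ℕ) = x) ∨ ∃ f < e, (C.bRet g m f : ℕ) = x := by
  induction m using WellFoundedLT.induction with
  | ind m ih =>
    by_cases hnew : x < C.lastExitBefore g m
    · obtain ⟨i, him, f, hxf⟩ := (C.lt_lastExitBefore_iff g m x).1 hnew
      refine .inl ?_
      rcases hxf.eq_or_lt with heq | hlt
      · exact ⟨i, him, f, heq.symm⟩
      · rcases ih i him hlt with ⟨j, hji, hj⟩ | ⟨f', _, hf'⟩
        · exact ⟨j, hji.trans him, hj⟩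
        · exact ⟨i, him, f', hf'⟩
    · rw [not_lt] at hnew
      obtain ⟨f, rfl⟩ := C.exists_bRet_eq_of_lastExitBefore_le g m hnew hx
      refine .inr ⟨f, lt_of_not_ge fun hef => ?_, rfl⟩
      rcases hef.eq_or_lt with rfl | hef
      · exact hx.false
      · exact (C.bRet_lt_bRet_of_lastExitBefore_le g m hef (hnew.trans hx.le) hnew).asymm
          (Fin.lt_def.2 hx)

end ExitOrder

theorem isRestrictedGrowth_run : ∀ {l : ℕ} (g : C.Grouping l),
    IsRestrictedGrowth fun a : Lex (Assignment l) => (C.run g (ofLex a) : ℕ)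
  | 0, g => fun a x hx => by
    simp only [MockCFLOBDD.run] at hx
    have hlt := (C.branch g (ofLex a ⟨0, by norm_num⟩)).isLt
    rcases C.dontCare_or_fork g with h | ⟨h, h0, h1⟩
    · omega
    · cases ha : ofLex a ⟨0, by norm_num⟩ with
      | false => rw [ha] at hx; omega
      | true =>
        refine ⟨toLex fun _ => false, ⟨⟨0, by norm_num⟩, fun j hj => ?_, ?_⟩, ?_⟩
        · exact absurd (Fin.lt_def.1 hj) (Nat.not_lt_zero _)
        · exact (Bool.false_lt_true).trans_eq ha.symm
        · exact h0.trans (by rw [ha] at hx; omega)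
  | l + 1, g => fun c x hx => by
    obtain ⟨a, b, hab⟩ := Assignment.exists_append_eq (ofLex c)
    obtain rfl : toLex (a.append b) = c := hab
    simp only [ofLex_toLex, C.run_append] at hx
    rcases C.exists_bRet_eq_of_lt g _ hx with ⟨i, hi, f, rfl⟩ | ⟨f, hf, rfl⟩
    · obtain ⟨a', ha', hi'⟩ := isRestrictedGrowth_run (C.aCall g) (toLex a) i
        ((Fin.lt_def.1 hi).trans_eq (C.midAfter_val g a))
      obtain rfl : C.midAfter g (ofLex a') = i := Fin.ext ((C.midAfter_val g _).trans hi')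
      obtain ⟨b', rfl⟩ := C.run_surjective _ f
      exact ⟨toLex ((ofLex a').append b'), Assignment.toLex_append_lt_of_lt_left ha' b' b,
        congrArg Fin.val (C.run_append g _ b')⟩
    · obtain ⟨b', hb', hf'⟩ := isRestrictedGrowth_run _ (toLex b) f hf
      obtain rfl : C.run _ (ofLex b') = f := Fin.ext hf'
      exact ⟨toLex (a.append (ofLex b')), Assignment.toLex_append_lt_of_lt_right a hb',
        congrArg Fin.val (C.run_append g a _)⟩

theorem run_val_eq_of_ker_run_eq {g h : C.Grouping l}
    (H : Setoid.ker (C.run g) = Setoid.ker (C.run h)) (a : Assignment l) :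
    (C.run g a : ℕ) = C.run h a := by
  refine congrFun ((C.isRestrictedGrowth_run g).eq_of_ker_eq (C.isRestrictedGrowth_run h) ?_)
    (toLex a)
  exact (ker_comp_of_injective Fin.val_injective _).trans
    (H.trans (ker_comp_of_injective Fin.val_injective _).symm)

theorem numExits_eq_of_ker_run_eq {g h : C.Grouping l}
    (H : Setoid.ker (C.run g) = Setoid.ker (C.run h)) : C.numExits g = C.numExits h := by
  suffices hle : ∀ {g h : C.Grouping l}, Setoid.ker (C.run g) = Setoid.ker (C.run h) →
      C.numExits g ≤ C.numExits h from (hle H).antisymm (hle H.symm)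
  intro g h H
  refine Nat.le_of_not_lt fun hlt => ?_
  obtain ⟨a, ha⟩ := C.run_surjective g ⟨C.numExits h, hlt⟩
  have hval := C.run_val_eq_of_ker_run_eq H a
  rw [ha] at hval
  exact (C.run h a).isLt.ne' hval

theorem ker_run_bCall_midAfter (g : C.Grouping (l + 1)) (a : Assignment l) :
    Setoid.ker (C.run (C.bCall g (C.midAfter g a))) =
      Setoid.ker fun b => C.run g (a.append b) := by
  simp only [C.run_append]
  exact (ker_comp_of_injective (C.b_injective g _) _).symm

theorem ofFn_eq_ofFn_of_comp_run_eq {α : Type*} {g h : C.Grouping l} (hgh : g = h)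
    {φ : Fin (C.numExits g) → α} {ψ : Fin (C.numExits h) → α}
    (H : ∀ a, φ (C.run g a) = ψ (C.run h a)) : List.ofFn φ = List.ofFn ψ := by
  subst hgh
  exact congrArg _ (funext ((C.run_surjective g).forall.2 H))

theorem bCall_eq_and_bTuple_eq
    (canon : Injective fun g : C.Grouping l => Setoid.ker (C.run g))
    {g h : C.Grouping (l + 1)} {a a' : Assignment l}
    (H : ∀ b, (C.run g (a.append b) : ℕ) = C.run h (a'.append b)) :
    C.bCall g (C.midAfter g a) = C.bCall h (C.midAfter h a') ∧
      C.bTuple g (C.midAfter g a) = C.bTuple h (C.midAfter h a') := by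
  have hcall : C.bCall g (C.midAfter g a) = C.bCall h (C.midAfter h a') := by
    refine canon ?_
    change Setoid.ker _ = Setoid.ker _
    rw [C.ker_run_bCall_midAfter, C.ker_run_bCall_midAfter]
    exact Setoid.ext fun b b' => by simp only [Setoid.ker_def, Fin.ext_iff, H]
  refine ⟨hcall, C.ofFn_eq_ofFn_of_comp_run_eq hcall fun b => ?_⟩
  rw [← C.run_append, ← C.run_append, H]

theorem ker_run_aCall (canon : Injective fun g : C.Grouping l => Setoid.ker (C.run g))
    (g : C.Grouping (l + 1)) :
    Setoid.ker (C.run (C.aCall g)) =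
      Setoid.ker fun a b : Assignment l => C.run g (a.append b) := by
  refine Setoid.ext fun a a' => ⟨fun h => funext fun b => ?_, fun h => ?_⟩
  · have hmid : C.midAfter g a = C.midAfter g a' := congrArg (C.aRet g) h
    change C.run g (Assignment.append a b) = C.run g (Assignment.append a' b)
    rw [C.run_append, C.run_append, hmid]
  · obtain ⟨hcall, htuple⟩ := C.bCall_eq_and_bTuple_eq canon (a := a) (a' := a')
      fun b => congrArg Fin.val (congrFun h b)
    by_contra hne
    exact C.b_distinct g _ _ ((C.aRet_injective g).ne hne) (hcall ▸ C.sameProto_refl _) htuple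

theorem sameProto_of_ker_run_eq
    (canon : Injective fun g : C.Grouping l => Setoid.ker (C.run g))
    {g h : C.Grouping (l + 1)}
    (H : Setoid.ker (C.run g) = Setoid.ker (C.run h)) : C.SameProto g h := by
  have hA : C.aCall g = C.aCall h := canon <|
    (C.ker_run_aCall canon g).trans <|
      (ker_curry_eq_of_ker_eq H _).trans (C.ker_run_aCall canon h).symm
  refine ⟨C.numExits_eq_of_ker_run_eq H, ?_, hA ▸ C.sameProto_refl _, ?_, fun i j hij => ?_⟩
  · rw [(C.a_identity g).1, (C.a_identity h).1, hA]
  · rw [(C.a_identity g).2, (C.a_identity h).2, hA]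
  · obtain ⟨a, rfl⟩ := C.midAfter_surjective g i
    obtain rfl : C.midAfter h a = j := Fin.ext <| by
      rw [← hij, C.midAfter_val, C.midAfter_val, hA]
    obtain ⟨hB, htuple⟩ := C.bCall_eq_and_bTuple_eq canon (a := a) (a' := a)
      fun b => C.run_val_eq_of_ker_run_eq H (a.append b)
    exact ⟨hB ▸ C.sameProto_refl _, htuple⟩

theorem ker_run_injective (l : ℕ) :
    Injective fun g : C.Grouping l => Setoid.ker (C.run g) := by
  induction l with
  | zero =>
    intro g h H
    refine C.no_duplicates g h ⟨C.numExits_eq_of_ker_run_eq H, fun b => ?_⟩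
    exact C.run_val_eq_of_ker_run_eq H fun _ => b
  | succ l canon => exact fun g h H => C.no_duplicates g h (C.sameProto_of_ker_run_eq canon H)

/-- The grouping `g` induces the same partition of the assignments to its variables as reading
that many variables from the node `u` of `B`.  The bound on the depth of `u` keeps the walk within
the plies of `B`, where `BDD.step` follows genuine edges. -/
def RealizedAt {n : ℕ} (g : C.Grouping l) (B : BDD V n) (u : B.Vertex) : Prop :=
  u.1 + 2 ^ l ≤ n ∧ Setoid.ker (C.run g) = Setoid.ker fun a : Assignment l => B.walk u a

section Realization

variable {C} {n : ℕ} {B : BDD V n} {u : B.Vertex}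

theorem RealizedAt.eq {g h : C.Grouping l} (hg : C.RealizedAt g B u) (hh : C.RealizedAt h B u) :
    g = h :=
  C.ker_run_injective l (hg.2.trans hh.2.symm)

theorem RealizedAt.aCall {g : C.Grouping (l + 1)} (hg : C.RealizedAt g B u) :
    C.RealizedAt (C.aCall g) B u := by
  obtain ⟨hn, hker⟩ := hg
  rw [Assignment.two_pow_succ_eq_add, ← add_assoc] at hn
  refine ⟨(Nat.le_add_right _ _).trans hn, ?_⟩
  rw [C.ker_run_aCall (C.ker_run_injective l), ker_curry_eq_of_ker_eq hker,
    B.ker_walk_eq_ker_walk_walk u hn]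
  simp only [B.walk_assignment_append]

theorem RealizedAt.bCall {g : C.Grouping (l + 1)} (hg : C.RealizedAt g B u) (a : Assignment l) :
    C.RealizedAt (C.bCall g (C.midAfter g a)) B (B.walk u a) := by
  obtain ⟨hn, hker⟩ := hg
  rw [Assignment.two_pow_succ_eq_add, ← add_assoc] at hn
  refine ⟨by rwa [B.fst_walk u a ((Nat.le_add_right _ _).trans hn)], ?_⟩
  rw [C.ker_run_bCall_midAfter]
  refine Setoid.ext fun b b' => (Setoid.ext_iff.1 hker _ _).trans ?_
  simp only [Setoid.ker_def, B.walk_assignment_append]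

end Realization

section Counting

variable {C} {B : BDD V (2 ^ k)}

theorem realizedAt_head (h : C.eval = B.eval) : C.RealizedAt C.head B ⟨0, B.root⟩ := by
  refine ⟨(Nat.zero_add _).le, ?_⟩
  rw [B.ker_walk_root, ← h]
  exact (ker_comp_of_injective C.value_injective _).symm

theorem exists_realizedAt (h : C.eval = B.eval) (g : C.Grouping l) :
    ∃ u, C.RealizedAt g B u := by
  have hl : l ≤ k := not_lt.1 fun hl => (C.no_grouping_above l hl).false g
  induction hl using Nat.decreasingInduction with
  | self => exact ⟨_, C.head_unique g ▸ realizedAt_head h⟩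
  | of_succ l hl ih =>
    obtain ⟨caller, hcaller⟩ := C.called hl g
    obtain ⟨u, hu⟩ := ih caller
    rcases hcaller with rfl | ⟨m, rfl⟩
    · exact ⟨u, hu.aCall⟩
    · obtain ⟨a, rfl⟩ := C.midAfter_surjective caller m
      exact ⟨_, hu.bCall a⟩

theorem numGroupings_le (h : C.eval = B.eval) :
    C.numGroupings ≤ (k + 1) * Nat.card B.Nonterminal := by
  have := B.finite_nodes
  choose node hnode using fun g : Σ l, C.Grouping l => exists_realizedAt h g.2
  have level_lt : ∀ g : Σ l, C.Grouping l, g.1 < k + 1 := fun g =>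
    not_le.1 fun hl => (C.no_grouping_above g.1 hl).false g.2
  have depth_lt : ∀ g, (node g).1 < 2 ^ k := fun g =>
    (Nat.lt_add_of_pos_right (Nat.two_pow_pos g.1)).trans_le (hnode g).1
  let address : (Σ l, C.Grouping l) → Fin (k + 1) × B.Nonterminal := fun g =>
    (⟨g.1, level_lt g⟩, ⟨node g, depth_lt g⟩)
  have address_injective : Injective address := by
    rintro ⟨l, g⟩ ⟨l', g'⟩ heq
    simp only [address, Prod.mk.injEq, Fin.mk.injEq, Subtype.mk.injEq] at heq
    obtain ⟨rfl, hnodes⟩ := heq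
    have hg := hnode ⟨l, g⟩
    rw [hnodes] at hg
    exact congrArg _ (hg.eq (hnode ⟨l, g'⟩))
  simpa only [MockCFLOBDD.numGroupings, Nat.card_prod, Nat.card_fin] using
    Nat.card_le_card_of_injective address address_injective

theorem eval_eq_of_represents {f : (Fin (2 ^ k) → Bool) → V} {ord : Equiv.Perm (Fin (2 ^ k))}
    (hB : B.Represents ord f) (hC : C.Represents ord f) : C.eval = B.eval := by
  ext a
  simpa only [comp_apply, Equiv.symm_apply_apply] using
    (hC (a ∘ ord.symm)).trans (hB (a ∘ ord.symm)).symm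

end Counting

end CFLOBDD

theorem succ_mul_le_mul_log {k M N : ℕ} (hM : 2 ^ k ≤ M) (hN : M < N) :
    ((k + 1) * M : ℝ) ≤ 2 / Real.log 2 * (N * Real.log N) := by
  have hlog : 0 < Real.log 2 := Real.log_pos one_lt_two
  have hpow : 2 ^ (k + 1) ≤ N ^ 2 := by
    rw [pow_succ]
    nlinarith
  have hlevels : (k + 1) * Real.log 2 ≤ 2 * Real.log N := by
    have h := Real.log_le_log (by positivity) (by exact_mod_cast hpow : (2 : ℝ) ^ (k + 1) ≤ N ^ 2)
    simpa only [Real.log_pow, Nat.cast_add, Nat.cast_one, Nat.cast_ofNat] using h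
  calc ((k + 1) * M : ℝ)
      ≤ 2 * Real.log N / Real.log 2 * N := by
        gcongr
        rwa [le_div_iff₀ hlog]
    _ = 2 / Real.log 2 * (N * Real.log N) := by ring

theorem mainTheorem4 :
    ∃ K : ℝ, 0 < K ∧
      ∀ (V : Type u) (k : ℕ) (f : (Fin (2 ^ k) → Bool) → V) (ord : Equiv.Perm (Fin (2 ^ k)))
        (B : BDD V (2 ^ k)) (C : CFLOBDD V k),
        B.Represents ord f → C.Represents ord f →
          (C.numGroupings : ℝ) ≤ K * (B.numNodes * Real.log B.numNodes) ∧
          (C.numGroupings : ℝ) ≤ K * (B.numEdges * Real.log B.numEdges) := by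
  refine ⟨2 / Real.log 2, div_pos two_pos (Real.log_pos one_lt_two), ?_⟩
  intro V k f ord B C hB hC
  have hplies : 2 ^ k ≤ Nat.card B.Nonterminal := B.le_card_nonterminal
  have hnodes : Nat.card B.Nonterminal < B.numNodes := B.card_nonterminal_lt_numNodes
  have hedges : Nat.card B.Nonterminal < B.numEdges := by
    have := Nat.two_pow_pos k
    rw [B.numEdges_eq_card_nonterminal_mul_two]
    omega
  have hgroupings : (C.numGroupings : ℝ) ≤ (k + 1) * Nat.card B.Nonterminal := by
    exact_mod_cast CFLOBDD.numGroupings_le (CFLOBDD.eval_eq_of_represents hB hC)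
  exact ⟨hgroupings.trans (succ_mul_le_mul_log hplies hnodes),
    hgroupings.trans (succ_mul_le_mul_log hplies hedges)⟩
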